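/- Let $p>3$ be a prime. Let $\mathbb Z_p$ denote the set of rational numbers whose denominator is not divisible by $p$; for rational $x,y$ write $x\equiv y \pmod p$ if $x-y=pc$ for some $c\in\mathbb Z_p$. Let $\left(\frac{\cdot}{p}\right)$ be the Legendre symbol, extended to $\mathbb Z_p$ by $\left(\frac{u/v}{p}\right)=\left(\frac{uv}{p}\right)$ for integers $u,v$ with $p\nmid v$. Let $[x]$ be the greatest integer not exceeding $x$, and for $a\in\mathbb Z_p$ put $S_p(a)=\sum_{k=1}^{[p/3]}\binom{3k}{k}a^k$. (1) If $n\in\mathbb Z_p$ and $3n+2\not\equiv 0\pmod p$, then $$S_p\big(n^2(n+1)\big)\equiv \frac{3(n+1)}{2(3n+2)}\left(\left(\frac{(1+n)(1-3n)}{p}\right)-1\right)\pmod p.$$ (2) Modulo $p$, $$S_p(2)\equiv\tfrac35\big((-1)^{(p-1)/2}-1\big)\ (p\ne5),\qquad S_p(-4)\equiv\tfrac38\left(\left(\tfrac{-7}{p}\right)-1\right),$$ $$S_p(12)\equiv\tfrac9{16}\left(\left(\tfrac{-15}{p}\right)-1\right),\qquad S_p(-18)\equiv\tfrac37\left(\left(\tfrac{-5}{p}\right)-1\right)\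 (p\ne7).$$ (3) Modulo $p$, $$S_p(36)\equiv\tfrac6{11}\left(\left(\tfrac{-2}{p}\right)-1\right)\ (p\ne11),\qquad S_p(-100)\equiv\tfrac6{13}\big((-1)^{(p-1)/2}-1\big)\ (p\ne13),$$ $$S_p\big(\tfrac18\big)\equiv\tfrac32\left(\left(\tfrac5p\right)-1\right),\qquad S_p\big(\tfrac38\big)\equiv\tfrac9{14}\left(\left(\tfrac{-3}{p}\right)-1\right)\ (p\ne7).$$ (4) If $m\in\mathbb Z_p$ and $m\not\equiv-3,9\pmod p$, then $$S_p\left(\frac{4(m-1)^2}{(m+3)^3}\right)\equiv\frac{6}{m-9}\left(1-\left(\frac mp\right)\right)\pmod p.$$ -/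

import Mathlib

namespace CubicSum

/-- `x ∈ ℤ_p`, where `ℤ_p` means the `p`-integral rationals: `x` is a rational number whose (reduced) denominator
is not divisible by `p`. -/
def IsPIntegral (p : ℕ) (x : ℚ) : Prop := ¬ p ∣ x.den

/-- The congruence `x ≡ y (mod p)`: `x - y` is `p` times a rational number whose denominator
is not divisible by `p`. -/
def ModEq (p : ℕ) (x y : ℚ) : Prop := ∃ c : ℚ, IsPIntegral p c ∧ x - y = p * c

/-- The Legendre symbol of a rational number `x = u / v` whose denominator `v` is prime to `p`:
since `u / v ≡ (u v) * (1 / v) ^ 2`, it is the usual Legendre symbol of the integer `u v`. -/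
def legendre (p : ℕ) [Fact p.Prime] (x : ℚ) : ℤ := legendreSym p (x.num * x.den)

/-- The sum `∑_{k=1}^{[p/3]} C(3k, k) a ^ k`. -/
def cubicSum (p : ℕ) (a : ℚ) : ℚ := ∑ k ∈ Finset.Icc 1 (p / 3), ((3 * k).choose k : ℚ) * a ^ k

end CubicSum

open Finset

namespace CubicSum

/-! ### The sums `∑ k, C(m + k, 2k) y ^ k` -/

/-! Let m = [p/3]. Since (3m+1)(3m+2) ≡ 0 mod p, the term ratios of C(3k,k) and (-27)^k C(m+k,2k)
agree, so 1 + S_p(a) is the Morgan-Voyce polynomial at y = -27a (`choose_three_mul_eq`). If u + 1/u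
= y + 2, that polynomial has a closed form in powers of u (`morganVoyce_mul`).

For a = n²(n+1) and v = -(3n+1) one has y + 2 = v³ - 3v, so u = w³ with w + 1/w = v. As 3m is p-1 or
p-2, u^m is w^p times a power of w, and Frobenius fixes or inverts w according to the character of
v² - 4 = -3(1+n)(1-3n). The character of -3 depends only on p mod 3 and cancels the dependence of m
on p mod 3. The value is 1 or -1/(3n+2). The zeros of (1+n)(1-3n) are treated directly, and
`Reduces` carries the identity from `ZMod p` back to rationals. -/

/-- The Morgan-Voyce polynomial `∑ k, C(m + k, 2k) y ^ k`. -/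
def morganVoyce {K : Type*} [CommRing K] (m : ℕ) (y : K) : K :=
  ∑ k ∈ range (m + 1), ((m + k).choose (2 * k) : K) * y ^ k

/-- Pascal's rule applied three times; this is the coefficient form of the recurrence
`morganVoyce_add_two`. -/
theorem choose_second_difference (m k : ℕ) :
    (m + 2 + (k + 1)).choose (2 * (k + 1)) + (m + (k + 1)).choose (2 * (k + 1)) =
      (m + 1 + k).choose (2 * k) + 2 * (m + 1 + (k + 1)).choose (2 * (k + 1)) := by
  have h1 : (m + 2 + (k + 1)).choose (2 * (k + 1)) =
      (m + k + 2).choose (2 * k + 1) + (m + k + 2).choose (2 * k + 2) := by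
    rw [show m + 2 + (k + 1) = m + k + 2 + 1 by ring]
    exact Nat.choose_succ_succ (m + k + 2) (2 * k + 1)
  have h2 : (m + k + 2).choose (2 * k + 1) =
      (m + k + 1).choose (2 * k) + (m + k + 1).choose (2 * k + 1) :=
    Nat.choose_succ_succ _ _
  have h3 : (m + k + 2).choose (2 * k + 2) =
      (m + k + 1).choose (2 * k + 1) + (m + k + 1).choose (2 * k + 2) :=
    Nat.choose_succ_succ _ _
  rw [show m + 1 + (k + 1) = m + k + 2 by ring, show 2 * (k + 1) = 2 * k + 2 by ring] at *
  rw [show m + (k + 1) = m + k + 1 by ring, show m + 1 + k = m + k + 1 by ring]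
  omega

theorem morganVoyce_eq_sum_range {K : Type*} [CommRing K] {m N : ℕ} (h : m < N) (y : K) :
    morganVoyce m y = ∑ k ∈ range N, ((m + k).choose (2 * k) : K) * y ^ k := by
  refine sum_subset (range_subset_range.2 h) fun k _ hk => ?_
  rw [mem_range, not_lt] at hk
  rw [Nat.choose_eq_zero_of_lt (by omega), Nat.cast_zero, zero_mul]

theorem morganVoyce_zero {K : Type*} [CommRing K] (y : K) : morganVoyce 0 y = 1 := by
  simp [morganVoyce]

theorem morganVoyce_one {K : Type*} [CommRing K] (y : K) : morganVoyce 1 y = 1 + y := by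
  simp [morganVoyce, sum_range_succ]

theorem morganVoyce_add_two {K : Type*} [CommRing K] (m : ℕ) (y : K) :
    morganVoyce (m + 2) y = (y + 2) * morganVoyce (m + 1) y - morganVoyce m y := by
  rw [eq_sub_iff_add_eq, add_mul, morganVoyce_eq_sum_range (N := m + 3 + 1) (by omega) y,
    morganVoyce_eq_sum_range (m := m) (N := m + 3 + 1) (by omega) y]
  conv_rhs =>
    congr
    · rw [morganVoyce_eq_sum_range (N := m + 3) (by omega) y]
    · rw [morganVoyce_eq_sum_range (N := m + 3 + 1) (by omega) y]
  rw [sum_range_succ', sum_range_succ' _ (m + 3), sum_range_succ' _ (m + 3), mul_add, mul_sum,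
    mul_sum]
  have h : ∀ k, ((m + 2 + (k + 1)).choose (2 * (k + 1)) : K) * y ^ (k + 1) +
      ((m + (k + 1)).choose (2 * (k + 1)) : K) * y ^ (k + 1) =
      y * (((m + 1 + k).choose (2 * k) : K) * y ^ k) +
        2 * (((m + 1 + (k + 1)).choose (2 * (k + 1)) : K) * y ^ (k + 1)) := fun k => by
    have := congrArg (Nat.cast : ℕ → K) (choose_second_difference m k)
    push_cast at this
    linear_combination y ^ (k + 1) * this
  have hs := sum_congr (rfl : range (m + 3) = range (m + 3)) fun k _ => h k
  rw [sum_add_distrib, sum_add_distrib] at hs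
  simp only [mul_zero, Nat.choose_zero_right, Nat.cast_one, pow_zero, mul_one]
  linear_combination hs

/-- The hypothesis says y + 2 = u + 1/u, so u and 1/u are the characteristic roots of the
recurrence. At u = -1 both sides vanish and nothing is learned. -/
theorem morganVoyce_mul {K : Type*} [CommRing K] {u y : K} (h : u * y = (u - 1) ^ 2) (m : ℕ) :
    morganVoyce m y * (u + 1) * u ^ m = u ^ (2 * m + 1) + 1 := by
  induction m using Nat.twoStepInduction with
  | zero => rw [morganVoyce_zero]; ring
  | one => rw [morganVoyce_one]; linear_combination (u + 1) * h
  | more m h0 h1 =>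
    rw [morganVoyce_add_two]
    linear_combination (-u ^ 2) * h0 + (u * y + 2 * u) * h1 + (u ^ (2 * m + 3) + 1) * h

/-- The double root u = -1, where `morganVoyce_mul` is empty. -/
theorem morganVoyce_neg_four {K : Type*} [CommRing K] (m : ℕ) :
    morganVoyce m (-4 : K) = (-1) ^ m * (2 * m + 1) := by
  induction m using Nat.twoStepInduction with
  | zero => rw [morganVoyce_zero]; simp
  | one => rw [morganVoyce_one]; norm_num
  | more m h0 h1 =>
    rw [morganVoyce_add_two, h0, h1]
    push_cast
    ring

theorem map_morganVoyce {K L : Type*} [CommRing K] [CommRing L] (f : K →+* L) (m : ℕ) (y : K) :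
    f (morganVoyce m y) = morganVoyce m (f y) := by
  simp [morganVoyce, map_sum]

/-! ### Reduction of `C(3k, k)` modulo `p` -/

theorem choose_three_mul_succ (k : ℕ) :
    2 * (k + 1) * (2 * k + 1) * (3 * (k + 1)).choose (k + 1) =
      3 * (3 * k + 1) * (3 * k + 2) * (3 * k).choose k := by
  have h1 := Nat.add_one_mul_choose_eq (3 * k + 2) k
  have h2 := Nat.choose_mul_succ_eq (3 * k + 1) k
  have h3 := Nat.choose_mul_succ_eq (3 * k) k
  rw [show 3 * k + 1 + 1 - k = 2 * k + 2 by omega] at h2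
  rw [show 3 * k + 1 - k = 2 * k + 1 by omega] at h3
  rw [show 3 * (k + 1) = 3 * k + 2 + 1 by ring]
  have h4 : (k + 1) * ((2 * (k + 1) * (2 * k + 1)) * (3 * k + 2 + 1).choose (k + 1)) =
      (k + 1) * (3 * (3 * k + 1) * (3 * k + 2) * (3 * k).choose k) := by
    zify at *
    linear_combination (-2 * (k + 1) * (2 * k + 1) : ℤ) * h1 -
      (2 * k + 1) * (3 * k + 3) * h2 - (3 * k + 2) * (3 * k + 3) * h3
  exact Nat.eq_of_mul_eq_mul_left k.succ_pos h4

/-- Stated over ℤ because m - k may be negative. -/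
theorem choose_add_two_mul_succ (m k : ℕ) :
    ((2 * k + 2) * (2 * k + 1) * (m + (k + 1)).choose (2 * (k + 1)) : ℤ) =
      (m + k + 1) * (m - k) * (m + k).choose (2 * k) := by
  have h1 := Nat.add_one_mul_choose_eq (m + k) (2 * k + 1)
  have h2 := Nat.choose_succ_right_eq (m + k) (2 * k)
  rw [show m + (k + 1) = m + k + 1 by ring, show 2 * (k + 1) = 2 * k + 1 + 1 by ring]
  rcases le_or_gt k m with hk | hk
  · rw [show m + k - 2 * k = m - k by omega] at h2
    zify [hk] at h1 h2
    linear_combination (-(2 * k + 1) : ℤ) * h1 + (m + k + 1 : ℤ) * h2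
  · rw [Nat.choose_eq_zero_of_lt (by omega : m + k < 2 * k),
      Nat.choose_eq_zero_of_lt (by omega : m + k + 1 < 2 * k + 1 + 1)]
    simp

section

variable {p : ℕ} [Fact p.Prime]

theorem natCast_ne_zero_of_lt {a : ℕ} (h0 : 0 < a) (h : a < p) : (a : ZMod p) ≠ 0 := fun h' =>
  absurd (Nat.le_of_dvd h0 ((ZMod.natCast_eq_zero_iff a p).1 h')) (not_le.2 h)

theorem mod_three_of_three_lt (hp : 3 < p) : p % 3 = 1 ∨ p % 3 = 2 := by
  have h : ¬ 3 ∣ p := fun h => by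
    have := (Nat.prime_dvd_prime_iff_eq Nat.prime_three (Fact.out : p.Prime)).1 h
    omega
  omega

theorem three_mul_div_three (hp : 3 < p) :
    (3 * ((p / 3 : ℕ) : ZMod p) + 1) * (3 * ((p / 3 : ℕ) : ZMod p) + 2) = 0 := by
  rcases mod_three_of_three_lt hp with h | h
  · have : 3 * (p / 3) + 1 = p := by omega
    have := congrArg (Nat.cast : ℕ → ZMod p) this
    push_cast at this
    rw [this, CharP.cast_eq_zero (ZMod p) p, zero_mul]
  · have : 3 * (p / 3) + 2 = p := by omega
    have := congrArg (Nat.cast : ℕ → ZMod p) this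
    push_cast at this
    rw [this, CharP.cast_eq_zero (ZMod p) p, mul_zero]

theorem choose_three_mul_eq (hp : 3 < p) {k : ℕ} (hk : k ≤ p / 3) :
    ((3 * k).choose k : ZMod p) = (-27) ^ k * ((p / 3 + k).choose (2 * k) : ZMod p) := by
  induction k with
  | zero => simp
  | succ k ih =>
    have hk' : 3 * (k + 1) ≤ p := by omega
    have h1 := congrArg (Nat.cast : ℕ → ZMod p) (choose_three_mul_succ k)
    have h2 := congrArg (Int.cast : ℤ → ZMod p) (choose_add_two_mul_succ (p / 3) k)
    have h3 := three_mul_div_three hp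
    specialize ih (by omega)
    generalize p / 3 = m at h2 h3 ih ⊢
    -- Both factors are below p because 3(k+1) ≤ p, so the ratio may be cancelled.
    have h4 : (((2 * k + 2) * (2 * k + 1) : ℕ) : ZMod p) ≠ 0 := by
      rw [Nat.cast_mul]
      exact mul_ne_zero (natCast_ne_zero_of_lt (by omega) (by omega))
        (natCast_ne_zero_of_lt (by omega) (by omega))
    push_cast at h1 h2 h4
    rw [ih] at h1
    refine mul_left_cancel₀ h4 ?_
    linear_combination h1 - (-27) ^ (k + 1) * h2 +
      3 * (-27) ^ k * ((m + k).choose (2 * k) : ZMod p) * h3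

theorem one_add_sum_choose_three_mul (hp : 3 < p) (a : ZMod p) :
    1 + ∑ k ∈ Icc 1 (p / 3), ((3 * k).choose k : ZMod p) * a ^ k =
      morganVoyce (p / 3) (-27 * a) := by
  have h : Icc 1 (p / 3) = Ico 1 (p / 3 + 1) := by ext; simp
  rw [morganVoyce, range_eq_Ico, sum_eq_sum_Ico_succ_bot (by omega), h]
  congr 1
  · simp
  · refine sum_congr rfl fun k hk => ?_
    rw [choose_three_mul_eq hp (by rw [mem_Ico] at hk; omega), mul_pow]
    ring

/-! ### Evaluation in `ZMod p` -/

theorem ne_zero_of_three_lt (hp : 3 < p) : (2 : ZMod p) ≠ 0 ∧ (3 : ZMod p) ≠ 0 :=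
  ⟨by exact_mod_cast natCast_ne_zero_of_lt (p := p) two_pos (by omega),
    by exact_mod_cast natCast_ne_zero_of_lt (p := p) three_pos hp⟩

/-- Frobenius on a square root: d^p = (d²)^((p-1)/2) d. -/
theorem pow_eq_mul_of_sq_eq {K : Type*} [Field K] [Algebra (ZMod p) K] (hp : 3 < p) {d : K}
    {s : ZMod p} (h : d ^ 2 = algebraMap (ZMod p) K s) :
    d ^ p = algebraMap (ZMod p) K (s ^ (p / 2)) * d := by
  have hodd : 2 * (p / 2) + 1 = p :=
    Nat.two_mul_div_two_add_one_of_odd ((Fact.out : p.Prime).odd_of_ne_two (by omega))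
  conv_lhs => rw [← hodd]
  rw [pow_succ, pow_mul, h, map_pow]

theorem exists_isAlgClosed_algebra :
    ∃ (K : Type) (_ : Field K) (_ : Algebra (ZMod p) K), IsAlgClosed K :=
  ⟨AlgebraicClosure (ZMod p), inferInstance, inferInstance, inferInstance⟩

theorem neg_three_pow_half (hp : 3 < p) :
    (-3 : ZMod p) ^ (p / 2) = if p % 3 = 1 then 1 else -1 := by
  obtain ⟨K, _, _, _⟩ := exists_isAlgClosed_algebra (p := p)
  let f := algebraMap (ZMod p) K
  have : CharP K p := charP_of_injective_algebraMap f.injective p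
  have h3 : (3 : K) ≠ 0 := by
    have := (map_ne_zero f).2 (ne_zero_of_three_lt hp).2
    rwa [map_ofNat] at this
  obtain ⟨d, hd⟩ := IsAlgClosed.exists_pow_nat_eq (-3 : K) two_pos
  have hd0 : d ≠ 0 := by
    rintro rfl
    apply h3
    linear_combination hd
  have h2 : (2 : K) ≠ 0 := by
    have := (map_ne_zero f).2 (ne_zero_of_three_lt hp).1
    rwa [map_ofNat] at this
  -- w is a primitive cube root of unity, so w^p depends only on p mod 3.
  obtain ⟨w, hw⟩ : ∃ w : K, d = 2 * w + 1 := ⟨(d - 1) / 2, by field_simp; ring⟩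
  have hw3 : w ^ 3 = 1 := by
    have : (2 * 2 : K) * (w ^ 2 + w + 1) = 0 := by subst hw; linear_combination hd
    have := (mul_eq_zero.1 this).resolve_left (mul_ne_zero h2 h2)
    linear_combination (w - 1) * this
  have hw2 : w ^ 2 = -1 - w := by
    have : (2 * 2 : K) * (w ^ 2 + w + 1) = 0 := by subst hw; linear_combination hd
    have := (mul_eq_zero.1 this).resolve_left (mul_ne_zero h2 h2)
    linear_combination this
  have key : d ^ p = f ((-3) ^ (p / 2)) * d :=
    pow_eq_mul_of_sq_eq hp (by rw [hd, map_neg, map_ofNat])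
  have hdp : d ^ p = 2 * w ^ p + 1 := by
    have h2p : (2 : K) ^ p = 2 := by
      have := congrArg f (ZMod.pow_card (2 : ZMod p))
      rwa [map_pow, map_ofNat] at this
    rw [hw, add_pow_char, mul_pow, one_pow, h2p]
  have hwp : w ^ p = w ^ (p % 3) := by
    rw [← pow_mod_orderOf, ← pow_mod_orderOf w (p % 3), Nat.mod_mod_of_dvd]
    exact orderOf_dvd_of_pow_eq_one hw3
  apply f.injective
  apply mul_right_cancel₀ hd0
  rw [← key, hdp, hwp]
  rcases mod_three_of_three_lt hp with h | h
  · simp [h, hw]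
  · simp only [h, hw2, hw, OfNat.ofNat_ne_one, if_false, map_neg, map_one]
    ring

theorem pow_half_eq {a : ZMod p} (ha : a ≠ 0) :
    a ^ (p / 2) = 1 ∨ a ^ (p / 2) = -1 := ZMod.pow_div_two_eq_neg_one_or_one p ha

/-- If `w + w⁻¹` lies in the prime field, the Frobenius map sends `w` to `w` or `w⁻¹` according
to the quadratic character of the discriminant. -/
theorem pow_char_eq {K : Type*} [Field K] [Algebra (ZMod p) K] (hp : 3 < p) {w : K} {v : ZMod p}
    (hw : w ^ 2 + 1 = algebraMap (ZMod p) K v * w) :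
    ((v ^ 2 - 4) ^ (p / 2) = 1 → w ^ p = w) ∧ ((v ^ 2 - 4) ^ (p / 2) = -1 → w ^ p * w = 1) := by
  let f := algebraMap (ZMod p) K
  have : CharP K p := charP_of_injective_algebraMap f.injective p
  have h2 : (2 : K) ≠ 0 := by
    have := (map_ne_zero f).2 (ne_zero_of_three_lt hp).1
    rwa [map_ofNat] at this
  -- 2w - v is a square root of the discriminant v² - 4.
  have key := pow_eq_mul_of_sq_eq (K := K) hp (d := 2 * w - f v) (s := v ^ 2 - 4) (by
    rw [map_sub, map_pow, map_ofNat]; linear_combination 4 * hw)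
  have h2p : (2 : K) ^ p = 2 := by
    have := congrArg f (ZMod.pow_card (2 : ZMod p))
    rwa [map_pow, map_ofNat] at this
  have hvp : f v ^ p = f v := by rw [← map_pow, ZMod.pow_card]
  rw [sub_pow_char, mul_pow, h2p, hvp] at key
  constructor <;> intro h <;> rw [h] at key
  · rw [map_one] at key
    apply mul_left_cancel₀ h2
    linear_combination key
  · rw [map_neg, map_one] at key
    have : w ^ p = f v - w := by
      apply mul_left_cancel₀ h2
      linear_combination key
    rw [this]
    linear_combination -hw

theorem sum_choose_three_mul_of_ne (hp : 3 < p) {n : ZMod p} (hn : 3 * n + 2 ≠ 0)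
    (h1 : 1 + n ≠ 0) (h2 : 1 - 3 * n ≠ 0) :
    2 * (3 * n + 2) * morganVoyce (p / 3) (-27 * (n ^ 2 * (n + 1))) =
      3 * n + 1 + 3 * (n + 1) * ((1 + n) * (1 - 3 * n)) ^ (p / 2) := by
  obtain ⟨K, _, _, _⟩ := exists_isAlgClosed_algebra (p := p)
  let f := algebraMap (ZMod p) K
  obtain ⟨w, hw⟩ : ∃ w : K, w ^ 2 + 1 = f (-(3 * n + 1)) * w := by
    obtain ⟨d, hd⟩ := IsAlgClosed.exists_pow_nat_eq (f ((3 * n + 1) ^ 2 - 4)) two_pos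
    have h2 : (2 : K) ≠ 0 := by
      have := (map_ne_zero f).2 (ne_zero_of_three_lt hp).1
      rwa [map_ofNat] at this
    refine ⟨(d + f (-(3 * n + 1))) / 2, ?_⟩
    simp only [map_sub, map_pow, map_add, map_mul, map_neg, map_one, map_ofNat] at hd ⊢
    field_simp
    linear_combination hd
  have hw0 : w ≠ 0 := by rintro rfl; simp at hw
  have hfn : w ^ 2 + 1 = -(3 * f n + 1) * w := by
    rw [hw]; simp only [map_add, map_mul, map_neg, map_one, map_ofNat]
  have hn' : 3 * f n + 2 ≠ 0 := by
    have := (map_ne_zero f).2 hn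
    simpa only [map_add, map_mul, map_ofNat] using this
  have h2' : 1 - 3 * f n ≠ 0 := by
    have := (map_ne_zero f).2 h2
    simpa only [map_sub, map_mul, map_one, map_ofNat] using this
  have hq : w ^ 2 - w + 1 = -(3 * f n + 2) * w := by linear_combination hfn
  have hq0 : w ^ 2 - w + 1 ≠ 0 := by rw [hq]; exact mul_ne_zero (neg_ne_zero.2 hn') hw0
  have hw1 : w + 1 ≠ 0 := fun h => h2' (by
    have : w = -1 := by linear_combination h
    rw [this] at hfn
    linear_combination hfn)
  have hu1 : w ^ 3 + 1 ≠ 0 := by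
    rw [show w ^ 3 + 1 = (w + 1) * (w ^ 2 - w + 1) by ring]; exact mul_ne_zero hw1 hq0
  -- This is y + 2 = v³ - 3v = w³ + w⁻³.
  have hu : w ^ 3 * f (-27 * (n ^ 2 * (n + 1))) = (w ^ 3 - 1) ^ 2 := by
    simp only [map_add, map_mul, map_neg, map_one, map_ofNat, map_pow]
    have hv : (3 * f n + 1) * w = -(w ^ 2 + 1) := by linear_combination hfn
    have e : w ^ 3 * (-27 * (f n ^ 2 * (f n + 1))) =
        -((3 * f n + 1) * w) ^ 3 + 3 * w ^ 2 * ((3 * f n + 1) * w) - 2 * w ^ 3 := by ring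
    rw [e, hv]; ring
  set M := morganVoyce (p / 3) (-27 * (n ^ 2 * (n + 1))) with hM
  have key : f M * (w ^ 3 + 1) * (w ^ 3) ^ (p / 3) = (w ^ 3) ^ (2 * (p / 3) + 1) + 1 := by
    rw [hM, map_morganVoyce]; exact morganVoyce_mul hu _
  have hD : (1 + n) * (1 - 3 * n) ≠ 0 := mul_ne_zero h1 h2
  have hdisc : ((-(3 * n + 1)) ^ 2 - 4) ^ (p / 2) =
      (-3) ^ (p / 2) * ((1 + n) * (1 - 3 * n)) ^ (p / 2) := by
    rw [← mul_pow]; congr 1; ring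
  rw [neg_three_pow_half hp] at hdisc
  obtain ⟨hfix, hinv⟩ := pow_char_eq hp hw
  rw [hdisc] at hfix hinv
  -- the two possible values of the sum
  have case_one : f M = 1 → 2 * (3 * n + 2) * M = 3 * n + 1 + 3 * (n + 1) * 1 := fun h => by
    rw [show M = 1 from f.injective (by rw [h, map_one])]; ring
  have case_neg : f M * (w ^ 3 + 1) = w ^ 2 + w →
      2 * (3 * n + 2) * M = 3 * n + 1 + 3 * (n + 1) * (-1) := fun h => by
    have : (3 * n + 2) * M = -1 := f.injective (by
      simp only [map_add, map_mul, map_neg, map_one, map_ofNat]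
      have h' : f M * (w ^ 2 - w + 1) = w := by
        apply mul_left_cancel₀ hw1
        linear_combination h
      rw [hq] at h'
      apply mul_right_cancel₀ hw0
      linear_combination -h')
    linear_combination 2 * this
  -- u^m is w^(p-1) or w^(p-2); the sign of `neg_three_pow_half` decides whether w^p is w or 1/w.
  rcases mod_three_of_three_lt hp with hp3 | hp3
  · have e1 : (w ^ 3) ^ (p / 3) * w = w ^ p := by
      rw [← pow_mul, ← pow_succ]; congr 1; omega
    have e2 : (w ^ 3) ^ (2 * (p / 3) + 1) = w ^ p * w ^ p * w := by
      rw [← e1]; ring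
    rw [e2] at key
    rcases pow_half_eq hD with hc | hc <;> rw [hc]
    · apply case_one
      have hF := hfix (by simp [hp3, hc])
      rw [hF] at e1 key
      apply mul_right_cancel₀ (mul_ne_zero hu1 hw0)
      linear_combination w * key - f M * (w ^ 3 + 1) * e1
    · apply case_neg
      have hI := hinv (by simp [hp3, hc])
      have hw2 : (w ^ 3) ^ (p / 3) * w ^ 2 = 1 := by linear_combination w * e1 + hI
      linear_combination w ^ 2 * key - f M * (w ^ 3 + 1) * hw2 + (w * w ^ p * w + w) * hI
  · have e1 : (w ^ 3) ^ (p / 3) * w ^ 2 = w ^ p := by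
      rw [← pow_mul, ← pow_add]; congr 1; omega
    have e2 : (w ^ 3) ^ (2 * (p / 3) + 1) * w = w ^ p * w ^ p := by
      rw [← e1]; ring
    have hne : ¬ p % 3 = 1 := by omega
    rcases pow_half_eq hD with hc | hc <;> rw [hc]
    · apply case_one
      have hI := hinv (by simp [hne, hc])
      have hw3 : (w ^ 3) ^ (p / 3) * w ^ 3 = 1 := by linear_combination w * e1 + hI
      apply mul_right_cancel₀ hu1
      linear_combination w ^ 3 * key - f M * (w ^ 3 + 1) * hw3 + w ^ 2 * e2 +
        (w ^ p * w + 1) * hI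
    · apply case_neg
      have hF := hfix (by simp [hne, hc])
      rw [hF] at e1 e2
      apply mul_right_cancel₀ hw0
      linear_combination w ^ 2 * key - f M * (w ^ 3 + 1) * e1 + w * e2

/-- As p is odd, [p/3] is even for p ≡ 1 mod 3 and odd for p ≡ 2, which matches the sign of 2[p/3] +
1 ≡ ±1/3. -/
theorem neg_one_pow_div_three (hp : 3 < p) :
    3 * ((-1 : ZMod p) ^ (p / 3) * (2 * (p / 3 : ℕ) + 1)) = 1 := by
  have hodd := (Fact.out : p.Prime).odd_of_ne_two (by omega)
  have hodd2 := Nat.odd_iff.1 hodd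
  rcases mod_three_of_three_lt hp with h | h
  · rw [Even.neg_one_pow (Nat.even_iff.2 (by omega))]
    have : 3 * (p / 3) + 1 = p := by omega
    have := congrArg (Nat.cast : ℕ → ZMod p) this
    push_cast at this
    rw [CharP.cast_eq_zero (ZMod p) p] at this
    linear_combination 2 * this
  · rw [Odd.neg_one_pow (Nat.odd_iff.2 (by omega))]
    have : 3 * (p / 3) + 2 = p := by omega
    have := congrArg (Nat.cast : ℕ → ZMod p) this
    push_cast at this
    rw [CharP.cast_eq_zero (ZMod p) p] at this
    linear_combination -2 * this

theorem two_mul_morganVoyce (hp : 3 < p) {n : ZMod p} (hn : 3 * n + 2 ≠ 0) :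
    2 * (3 * n + 2) * morganVoyce (p / 3) (-27 * (n ^ 2 * (n + 1))) =
      3 * n + 1 + 3 * (n + 1) * ((1 + n) * (1 - 3 * n)) ^ (p / 2) := by
  by_cases h1 : 1 + n = 0
  · have : n = -1 := by linear_combination h1
    subst this
    rw [← one_add_sum_choose_three_mul hp]
    rw [sum_eq_zero fun k hk => by
      rw [mem_Icc] at hk
      rw [show ((-1) ^ 2 * (-1 + 1) : ZMod p) = 0 by ring, zero_pow (by omega), mul_zero]]
    ring
  by_cases h2 : 1 - 3 * n = 0
  · rw [h2, mul_zero, zero_pow (by omega)]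
    -- n = 1/3 gives w = u = -1.
    have h4 : -27 * (n ^ 2 * (n + 1)) = -4 := by
      linear_combination (9 * n ^ 2 + 12 * n + 4) * h2
    rw [h4, morganVoyce_neg_four]
    have := neg_one_pow_div_three hp
    linear_combination 2 * this - (2 * ((-1 : ZMod p) ^ (p / 3) * (2 * (p / 3 : ℕ) + 1)) - 1) * h2
  · exact sum_choose_three_mul_of_ne hp hn h1 h2

/-- The main congruence, as an identity in `ZMod p`. -/
theorem sum_choose_three_mul (hp : 3 < p) {n : ZMod p} (hn : 3 * n + 2 ≠ 0) :
    ∑ k ∈ Icc 1 (p / 3), ((3 * k).choose k : ZMod p) * (n ^ 2 * (n + 1)) ^ k =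
      3 * (n + 1) / (2 * (3 * n + 2)) * (((1 + n) * (1 - 3 * n)) ^ (p / 2) - 1) := by
  have h := two_mul_morganVoyce hp hn
  rw [← one_add_sum_choose_three_mul hp] at h
  have h2 := (ne_zero_of_three_lt hp).1
  rw [div_mul_eq_mul_div, eq_div_iff (mul_ne_zero h2 hn)]
  linear_combination h

theorem mul_sq_pow_half (hp : 3 < p) {d c : ZMod p} (hc : c ≠ 0) :
    (d * c ^ 2) ^ (p / 2) = d ^ (p / 2) := by
  have hodd : 2 * (p / 2) + 1 = p :=
    Nat.two_mul_div_two_add_one_of_odd ((Fact.out : p.Prime).odd_of_ne_two (by omega))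
  rw [mul_pow, ← pow_mul, show 2 * (p / 2) = p - 1 by omega, ZMod.pow_card_sub_one_eq_one hc,
    mul_one]

/-- The main congruence with the argument of the character given up to a square. -/
theorem sum_choose_three_mul_of_eq (hp : 3 < p) {a n d c : ZMod p} (hn : 3 * n + 2 ≠ 0)
    (ha : a = n ^ 2 * (n + 1)) (hc : c ≠ 0) (hd : (1 + n) * (1 - 3 * n) = d * c ^ 2) :
    ∑ k ∈ Icc 1 (p / 3), ((3 * k).choose k : ZMod p) * a ^ k =
      3 * (n + 1) / (2 * (3 * n + 2)) * (d ^ (p / 2) - 1) := by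
  rw [ha, sum_choose_three_mul hp hn, hd, mul_sq_pow_half hp hc]

end

/-! ### Reduction of `p`-integral rationals -/

/-- The rational `x` is `p`-integral with residue class `a`. -/
def Reduces (p : ℕ) [Fact p.Prime] (x : ℚ) (a : ZMod p) : Prop :=
  ∃ u v : ℤ, (v : ZMod p) ≠ 0 ∧ x = u / v ∧ a = u / v

section

variable {p : ℕ} [Fact p.Prime] {x y : ℚ} {a b : ZMod p}

theorem intCast_rat_ne_zero {v : ℤ} (h : (v : ZMod p) ≠ 0) : (v : ℚ) ≠ 0 := by
  rintro h'
  rw [Int.cast_eq_zero] at h'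
  simp [h'] at h

namespace Reduces

theorem intCast (z : ℤ) : Reduces p z z := ⟨z, 1, by simp, by simp, by simp⟩

theorem natCast (n : ℕ) : Reduces p n n := by simpa using intCast (p := p) n

theorem ofNat (n : ℕ) [n.AtLeastTwo] : Reduces p (OfNat.ofNat n) (OfNat.ofNat n) :=
  natCast (p := p) n

theorem zero : Reduces p 0 0 := by simpa using intCast (p := p) 0

theorem one : Reduces p 1 1 := by simpa using intCast (p := p) 1

theorem add (hx : Reduces p x a) (hy : Reduces p y b) : Reduces p (x + y) (a + b) := by
  obtain ⟨u, v, hv, rfl, rfl⟩ := hx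
  obtain ⟨s, t, ht, rfl, rfl⟩ := hy
  have hv' := intCast_rat_ne_zero hv
  have ht' := intCast_rat_ne_zero ht
  refine ⟨u * t + v * s, v * t, by push_cast; exact mul_ne_zero hv ht, ?_, ?_⟩
  · push_cast; exact div_add_div _ _ hv' ht'
  · push_cast; exact div_add_div _ _ hv ht

theorem mul (hx : Reduces p x a) (hy : Reduces p y b) : Reduces p (x * y) (a * b) := by
  obtain ⟨u, v, hv, rfl, rfl⟩ := hx
  obtain ⟨s, t, ht, rfl, rfl⟩ := hy
  refine ⟨u * s, v * t, by push_cast; exact mul_ne_zero hv ht, ?_, ?_⟩ <;>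
  · push_cast; exact div_mul_div_comm _ _ _ _

theorem neg (hx : Reduces p x a) : Reduces p (-x) (-a) := by
  simpa using (intCast (p := p) (-1)).mul hx

theorem sub (hx : Reduces p x a) (hy : Reduces p y b) : Reduces p (x - y) (a - b) := by
  simpa [sub_eq_add_neg] using hx.add hy.neg

theorem inv (hx : Reduces p x a) (ha : a ≠ 0) : Reduces p x⁻¹ a⁻¹ := by
  obtain ⟨u, v, hv, rfl, rfl⟩ := hx
  exact ⟨v, u, (div_ne_zero_iff.1 ha).1, by rw [inv_div], by rw [inv_div]⟩

theorem div (hx : Reduces p x a) (hy : Reduces p y b) (hb : b ≠ 0) :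
    Reduces p (x / y) (a / b) := by
  simpa [div_eq_mul_inv] using hx.mul (hy.inv hb)

theorem pow (hx : Reduces p x a) (n : ℕ) : Reduces p (x ^ n) (a ^ n) := by
  induction n with
  | zero => simpa using one (p := p)
  | succ n ih => rw [pow_succ, pow_succ]; exact ih.mul hx

theorem sum {ι : Type*} {s : Finset ι} {f : ι → ℚ} {g : ι → ZMod p}
    (h : ∀ i ∈ s, Reduces p (f i) (g i)) : Reduces p (∑ i ∈ s, f i) (∑ i ∈ s, g i) := by
  classical
  induction s using Finset.induction_on with
  | empty => simpa using zero (p := p)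
  | insert i s hi ih =>
    rw [sum_insert hi, sum_insert hi]
    exact (h i (mem_insert_self i s)).add (ih fun j hj => h j (mem_insert_of_mem hj))

theorem modEq (hx : Reduces p x a) (hy : Reduces p y a) : ModEq p x y := by
  obtain ⟨u, v, hv, h, h0⟩ := hx.sub hy
  rw [sub_self, eq_comm, div_eq_zero_iff, or_iff_left hv, ZMod.intCast_zmod_eq_zero_iff_dvd] at h0
  obtain ⟨c, rfl⟩ := h0
  refine ⟨c / v, fun hd => hv ?_, by rw [h]; push_cast; ring⟩
  rw [ZMod.intCast_zmod_eq_zero_iff_dvd]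
  -- The reduced denominator of c/v divides v.
  exact (Int.natCast_dvd_natCast.2 hd).trans (by simpa [Rat.divInt_eq_div] using Rat.den_dvd c v)

theorem of_isPIntegral (h : IsPIntegral p x) : Reduces p x (x.num / x.den) :=
  ⟨x.num, x.den, by rwa [Int.cast_natCast, Ne, ZMod.natCast_eq_zero_iff],
    by rw [Int.cast_natCast, Rat.num_div_den], by rw [Int.cast_natCast]⟩

theorem legendre (hp : 3 < p) (hx : Reduces p x a) :
    ((legendre p x : ℤ) : ZMod p) = a ^ (p / 2) := by
  obtain ⟨u, v, hv, h, rfl⟩ := hx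
  have hd : (x.den : ZMod p) ≠ 0 := by
    rw [Ne, ZMod.natCast_eq_zero_iff]
    intro h'
    apply hv
    rw [ZMod.intCast_zmod_eq_zero_iff_dvd]
    rw [h] at h'
    exact (Int.natCast_dvd_natCast.2 h').trans (by simpa [Rat.divInt_eq_div] using Rat.den_dvd u v)
  have e : x.num * v = u * x.den := by
    have hv' := intCast_rat_ne_zero hv
    have hd' : (x.den : ℚ) ≠ 0 := by exact_mod_cast x.den_ne_zero
    have : (x.num : ℚ) / x.den = u / v := by rw [Rat.num_div_den, h]
    rw [div_eq_div_iff hd' hv'] at this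
    exact_mod_cast this
  have e' := congrArg (Int.cast : ℤ → ZMod p) e
  push_cast at e'
  -- num · den is u/v times den², and the square does not affect the half power.
  rw [CubicSum.legendre, legendreSym.eq_pow, ← mul_sq_pow_half hp hd (d := (u : ZMod p) / v)]
  congr 1
  push_cast
  field_simp
  linear_combination e'

theorem cubicSum (hx : Reduces p x a) : Reduces p (cubicSum p x)
    (∑ k ∈ Icc 1 (p / 3), ((3 * k).choose k : ZMod p) * a ^ k) :=
  sum fun k _ => (natCast _).mul (hx.pow k)

end Reduces

theorem legendreSym_reduces (z : ℤ) :
    Reduces p (legendreSym p z : ℚ) ((z : ZMod p) ^ (p / 2)) := by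
  simpa [legendreSym.eq_pow] using Reduces.intCast (p := p) (legendreSym p z)

theorem legendre_reduces (hp : 3 < p) (hx : Reduces p x a) :
    Reduces p (legendre p x : ℚ) (a ^ (p / 2)) := by
  rw [← hx.legendre hp]
  exact Reduces.intCast _

/-- Common template for every case: n parametrizes a, c strips a square from the character's
argument, and t and r are rational lifts of the character and the coefficient. -/
theorem cubicSum_modEq {r t : ℚ} {n c d e : ZMod p} (hp : 3 < p)
    (hx : Reduces p x a) (hn : 3 * n + 2 ≠ 0) (ha : a = n ^ 2 * (n + 1)) (hc : c ≠ 0)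
    (hd : (1 + n) * (1 - 3 * n) = d * c ^ 2) (ht : Reduces p t (d ^ (p / 2)))
    (hr : Reduces p r e) (he : e * (2 * (3 * n + 2)) = 3 * (n + 1)) :
    ModEq p (cubicSum p x) (r * (t - 1)) := by
  have h := hx.cubicSum
  rw [sum_choose_three_mul_of_eq hp hn ha hc hd] at h
  refine h.modEq ?_
  rw [← eq_div_iff (mul_ne_zero (ne_zero_of_three_lt hp).1 hn)] at he
  rw [← he]
  exact hr.mul (ht.sub Reduces.one)

theorem primeCast_ne_zero {q : ℕ} (hq : q.Prime) (h : p ≠ q) : (q : ZMod p) ≠ 0 := by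
  rw [Ne, ZMod.natCast_eq_zero_iff, Nat.prime_dvd_prime_iff_eq Fact.out hq]
  exact h

end

end CubicSum

/-! ### The main congruence over the rationals and its specializations -/

theorem theorem2p3 (p : ℕ) [Fact p.Prime] (hp : 3 < p) :
    -- the main congruence
    (∀ n : ℚ, CubicSum.IsPIntegral p n → ¬ CubicSum.ModEq p (3 * n + 2) 0 →
      CubicSum.ModEq p (CubicSum.cubicSum p (n ^ 2 * (n + 1)))
        (3 * (n + 1) / (2 * (3 * n + 2)) *
          ((CubicSum.legendre p ((1 + n) * (1 - 3 * n)) : ℚ) - 1))) ∧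
    -- explicit values
    (p ≠ 5 → CubicSum.ModEq p (CubicSum.cubicSum p 2)
      (3 / 5 * ((-1 : ℚ) ^ ((p - 1) / 2) - 1))) ∧
    CubicSum.ModEq p (CubicSum.cubicSum p (-4))
      (3 / 8 * ((legendreSym p (-7) : ℚ) - 1)) ∧
    CubicSum.ModEq p (CubicSum.cubicSum p 12)
      (9 / 16 * ((legendreSym p (-15) : ℚ) - 1)) ∧
    (p ≠ 7 → CubicSum.ModEq p (CubicSum.cubicSum p (-18))
      (3 / 7 * ((legendreSym p (-5) : ℚ) - 1))) ∧
    (p ≠ 11 → CubicSum.ModEq p (CubicSum.cubicSum p 36)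
      (6 / 11 * ((legendreSym p (-2) : ℚ) - 1))) ∧
    (p ≠ 13 → CubicSum.ModEq p (CubicSum.cubicSum p (-100))
      (6 / 13 * ((-1 : ℚ) ^ ((p - 1) / 2) - 1))) ∧
    CubicSum.ModEq p (CubicSum.cubicSum p (1 / 8))
      (3 / 2 * ((legendreSym p 5 : ℚ) - 1)) ∧
    (p ≠ 7 → CubicSum.ModEq p (CubicSum.cubicSum p (3 / 8))
      (9 / 14 * ((legendreSym p (-3) : ℚ) - 1))) ∧
    -- the form with parameter `m`
    (∀ m : ℚ, CubicSum.IsPIntegral p m →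
      ¬ CubicSum.ModEq p m (-3) → ¬ CubicSum.ModEq p m 9 →
      CubicSum.ModEq p (CubicSum.cubicSum p (4 * (m - 1) ^ 2 / (m + 3) ^ 3))
        (6 / (m - 9) * (1 - (CubicSum.legendre p m : ℚ)))) := by

  open CubicSum Reduces in
  obtain ⟨h2, h3⟩ := ne_zero_of_three_lt hp
  have main : ∀ n : ℚ, IsPIntegral p n → ¬ ModEq p (3 * n + 2) 0 →
      ModEq p (cubicSum p (n ^ 2 * (n + 1)))
        (3 * (n + 1) / (2 * (3 * n + 2)) *
          ((legendre p ((1 + n) * (1 - 3 * n)) : ℚ) - 1)) := by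
    intro n hn h
    have hr := of_isPIntegral hn
    have h32 := ((Reduces.ofNat 3).mul hr).add (Reduces.ofNat 2)
    have hne : 3 * (n.num / n.den : ZMod p) + 2 ≠ 0 := fun h0 =>
      h ((h0 ▸ h32).modEq Reduces.zero)
    have hne' := mul_ne_zero h2 hne
    exact cubicSum_modEq hp ((hr.pow 2).mul (hr.add .one)) hne rfl one_ne_zero (by ring)
      (legendre_reduces hp ((Reduces.one.add hr).mul (Reduces.one.sub ((Reduces.ofNat 3).mul hr))))
      (((Reduces.ofNat 3).mul (hr.add .one)).div ((Reduces.ofNat 2).mul h32) hne')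
      (div_mul_cancel₀ _ hne')
  have h4 : (4 : ZMod p) ≠ 0 := by
    rw [show (4 : ZMod p) = 2 * 2 by norm_num]; exact mul_ne_zero h2 h2
  have h8 : (8 : ZMod p) ≠ 0 := by
    rw [show (8 : ZMod p) = 2 * 4 by norm_num]; exact mul_ne_zero h2 h4
  have h16 : (16 : ZMod p) ≠ 0 := by
    rw [show (16 : ZMod p) = 2 * 8 by norm_num]; exact mul_ne_zero h2 h8
  have half : 1 / 2 * 2 = (1 : ZMod p) := div_mul_cancel₀ _ h2
  have hhalf : (1 / 2 : ZMod p) ≠ 0 := div_ne_zero one_ne_zero h2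
  have hodd : (p - 1) / 2 = p / 2 := by
    have := Nat.odd_iff.1 ((Fact.out : p.Prime).odd_of_ne_two (by omega))
    omega
  have hneg : Reduces p ((-1) ^ ((p - 1) / 2)) ((-1 : ZMod p) ^ (p / 2)) := by
    rw [hodd]; exact Reduces.one.neg.pow _
  -- The special values use n = 1, -2, 2, -3, 3, -5, -1/2, 1/2; each excluded prime is the one
  -- greater than 3 dividing the numerator of 3n + 2.
  refine ⟨main, fun hq => ?_, ?_, ?_, fun hq => ?_, fun hq => ?_, fun hq => ?_, ?_,
    fun hq => ?_, ?_⟩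
  · have h5 : (5 : ZMod p) ≠ 0 := by exact_mod_cast primeCast_ne_zero Nat.prime_five hq
    exact cubicSum_modEq (n := 1) (c := 2) hp (.ofNat 2) (by norm_num; exact h5) (by norm_num) h2
      (by norm_num) hneg ((Reduces.ofNat 3).div (.ofNat 5) h5) (by field_simp; norm_num)
  · exact cubicSum_modEq (n := -2) (c := 1) hp (Reduces.ofNat 4).neg
      (by norm_num; exact h4) (by norm_num) one_ne_zero
      (by push_cast; norm_num) (legendreSym_reduces (-7)) ((Reduces.ofNat 3).div (.ofNat 8) h8)
      (by field_simp; norm_num)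
  · exact cubicSum_modEq (n := 2) (c := 1) hp (.ofNat 12)
      (by norm_num; exact h8) (by norm_num) one_ne_zero
      (by push_cast; norm_num) (legendreSym_reduces (-15)) ((Reduces.ofNat 9).div (.ofNat 16) h16)
      (by field_simp; norm_num)
  · have h7 : (7 : ZMod p) ≠ 0 := by exact_mod_cast primeCast_ne_zero Nat.prime_seven hq
    exact cubicSum_modEq (n := -3) (c := 2) hp (Reduces.ofNat 18).neg
      (by norm_num; exact h7) (by norm_num) h2
      (by push_cast; norm_num) (legendreSym_reduces (-5)) ((Reduces.ofNat 3).div (.ofNat 7) h7)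
      (by field_simp; norm_num)
  · have h11 : (11 : ZMod p) ≠ 0 := by exact_mod_cast primeCast_ne_zero (by norm_num) hq
    exact cubicSum_modEq (n := 3) (c := 4) hp (.ofNat 36)
      (by norm_num; exact h11) (by norm_num) h4
      (by push_cast; norm_num) (legendreSym_reduces (-2)) ((Reduces.ofNat 6).div (.ofNat 11) h11)
      (by field_simp; norm_num)
  · have h13 : (13 : ZMod p) ≠ 0 := by exact_mod_cast primeCast_ne_zero (by norm_num) hq
    exact cubicSum_modEq (n := -5) (c := 8) hp (Reduces.ofNat 100).neg
      (by norm_num; exact h13) (by norm_num) h8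
      (by norm_num) hneg ((Reduces.ofNat 6).div (.ofNat 13) h13) (by field_simp; norm_num)
  · exact cubicSum_modEq (n := -(1 / 2)) (c := 1 / 2) hp (Reduces.one.div (.ofNat 8) h8)
      (by rw [show 3 * -(1 / 2) + 2 = (1 / 2 : ZMod p) by linear_combination -2 * half]
          exact hhalf)
      (by field_simp; norm_num) hhalf
      (by push_cast; field_simp; norm_num) (legendreSym_reduces 5)
      ((Reduces.ofNat 3).div (.ofNat 2) h2) (by field_simp; norm_num)
  · have h7 : (7 : ZMod p) ≠ 0 := by exact_mod_cast primeCast_ne_zero Nat.prime_seven hq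
    have h14 : (14 : ZMod p) ≠ 0 := by
      rw [show (14 : ZMod p) = 2 * 7 by norm_num]; exact mul_ne_zero h2 h7
    exact cubicSum_modEq (n := 1 / 2) (c := 1 / 2) hp ((Reduces.ofNat 3).div (.ofNat 8) h8)
      (by rw [show 3 * (1 / 2) + 2 = (7 * (1 / 2) : ZMod p) by linear_combination -2 * half]
          exact mul_ne_zero h7 hhalf)
      (by field_simp; norm_num) hhalf
      (by push_cast; field_simp; norm_num) (legendreSym_reduces (-3))
      ((Reduces.ofNat 9).div (.ofNat 14) h14) (by field_simp; norm_num)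
  · intro m hm hm3 hm9
    have hr := of_isPIntegral hm
    have hl := legendre_reduces hp hr
    generalize (m.num / m.den : ZMod p) = b at hr hl
    have hb3 : b + 3 ≠ 0 := fun h => hm3 (by
      rw [show b = -3 by linear_combination h] at hr
      exact hr.modEq (Reduces.ofNat 3).neg)
    have hb9 : b - 9 ≠ 0 := fun h => hm9 (by
      rw [show b = 9 by linear_combination h] at hr
      exact hr.modEq (.ofNat 9))
    have e : 3 * ((1 - b) / (b + 3)) + 2 = -(b - 9) / (b + 3) := by field_simp; ring
    rw [show 6 / (m - 9) * (1 - (legendre p m : ℚ)) =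
      -(6 / (m - 9)) * ((legendre p m : ℚ) - 1) by ring]
    -- Solving 1 - 3n = b(1+n) gives this n, with 1 + n = 4/(b+3), so the character's argument is
    -- b(1+n)².
    exact cubicSum_modEq (n := (1 - b) / (b + 3)) (c := 4 / (b + 3)) hp
      (((Reduces.ofNat 4).mul ((hr.sub .one).pow 2)).div ((hr.add (.ofNat 3)).pow 3)
        (pow_ne_zero 3 hb3))
      (by rw [e]; exact div_ne_zero (neg_ne_zero.2 hb9) hb3)
      (by field_simp; ring) (div_ne_zero h4 hb3) (by field_simp; ring) hl
      ((Reduces.ofNat 6).div (hr.sub (.ofNat 9)) hb9).neg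
      (by rw [e]; field_simp; ring)
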